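/- Let $p>1$, $0\le \ell<u$, and let $n\ge 1$ be an integer; put $f(x):=x^p$. For a vector $\bm\xi=(\xi_0,\dots,\xi_n)$ of linearization points with $\ell=\xi_0<\xi_1<\dots<\xi_{n-1}<\xi_n=u$, let $P_0:=(\ell,f(\ell))$, let $P_{n+1}:=(u,f(u))$, and, for $1\le i\le n$, let $P_i$ be the intersection point of the tangent lines to the graph of $f$ at $\xi_{i-1}$ and at $\xi_i$, i.e. $$P_i=\bigl(\tau_i,\ f(\xi_i)+f'(\xi_i)(\tau_i-\xi_i)\bigr),\qquad \tau_i=\frac{[f(\xi_i)-f'(\xi_i)\xi_i]-[f(\xi_{i-1})-f'(\xi_{i-1})\xi_{i-1}]}{f'(\xi_{i-1})-f'(\xi_i)}.$$ Let $g:[\ell,u]\to\mathbb{R}$ be the piecewise-linear function whose graph connects $P_0,P_1,\dots,P_{n+1}$ in this order, and let $\invbreve{U}^*_p(\bm\xi)\subset\mathbb{R}^3$ be the closure of the convex hull of $$\Bigl\{(x,y,z)\ :\ \Bigl(g(\ell)-\tfrac{g(u)-g(\ell)}{u-\ell}\,\ell\Bigr)z+\tfrac{g(u)-g(\ell)}{u-\ell}\,x\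 \ge\ y\ \ge\ z\,g(x/z),\ \ uz\ge x\ge \ell z,\ \ 1\ge z>0,\ \ y\ge 0\Bigr\}.$$ Let $\mathrm{vol}$ denote Lebesgue measure on $\mathbb{R}^3$. Then, for every such $p,\ell,u,n$, the function $\bm\xi\mapsto \mathrm{vol}(\invbreve{U}^*_p(\bm\xi))$ has a unique minimizer over the set of all $\bm\xi$ with $\ell=\xi_0<\xi_1<\dots<\xi_{n-1}<\xi_n=u$; that is, exactly one $\bm\xi$ in this set attains the minimum of the volume over the set. -/

import Mathlib

/-- The perspective relaxation `S*_f(ℓ, u) ⊆ ℝ³` of a univariate function `f` on `[ℓ, u]`: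
the convex closure (closure of the convex hull) of the set of all `(x, y, z)` with `0 < z ≤ 1`,
`ℓ z ≤ x ≤ u z`, `y ≥ 0`, lying above the perspective `z f(x / z)` of `f` and below the
perspective of the chord of `f` over `[ℓ, u]`. -/
def perspectiveRelaxation (f : ℝ → ℝ) (ℓ u : ℝ) : Set (ℝ × ℝ × ℝ) :=
  closure (convexHull ℝ {q : ℝ × ℝ × ℝ | ∃ x y z : ℝ, q = (x, y, z) ∧
    y ≤ (f ℓ - (f u - f ℓ) / (u - ℓ) * ℓ) * z + (f u - f ℓ) / (u - ℓ) * x ∧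
    z * f (x / z) ≤ y ∧
    x ≤ u * z ∧ ℓ * z ≤ x ∧
    z ≤ 1 ∧ 0 < z ∧ 0 ≤ y})

/-- The abscissa `τ` of the intersection point of the tangent lines of `f` at `a` and at `b`. -/
noncomputable def tangentAbscissa (f : ℝ → ℝ) (a b : ℝ) : ℝ :=
  ((f b - deriv f b * b) - (f a - deriv f a * a)) / (deriv f a - deriv f b)

/-- The intersection point of the tangent lines of `f` at `a` and at `b`. -/
noncomputable def tangentIntersection (f : ℝ → ℝ) (a b : ℝ) : ℝ × ℝ :=
  (tangentAbscissa f a b, f b + deriv f b * (tangentAbscissa f a b - b))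

/-- The points `P₀, P₁, …, Pₙ, Pₙ₊₁` for the linearization points `ξ₀ < ξ₁ < ⋯ < ξₙ`:
`P₀ = (ξ₀, f ξ₀)`, `Pₙ₊₁ = (ξₙ, f ξₙ)`, and, for `1 ≤ i ≤ n`, `Pᵢ` is the intersection point of
the tangent lines of `f` at `ξᵢ₋₁` and at `ξᵢ`. -/
noncomputable def breakpoints {n : ℕ} (f : ℝ → ℝ) (ξ : Fin (n + 1) → ℝ) :
    Fin (n + 2) → ℝ × ℝ :=
  Fin.cons (α := fun _ => ℝ × ℝ) (ξ 0, f (ξ 0))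
    (Fin.snoc (α := fun _ => ℝ × ℝ)
      (fun i : Fin n => tangentIntersection f (ξ i.castSucc) (ξ i.succ))
      (ξ (Fin.last n), f (ξ (Fin.last n))))

/-- The piecewise-linear function whose graph connects the points `P 0, P 1, …, P m`, listed by
strictly increasing abscissa: the value at `P 0`, plus the slope of each segment times the length
of the part of the segment's base that lies to the left of `x`. -/
noncomputable def connectPoints {m : ℕ} (P : Fin (m + 1) → ℝ × ℝ) (x : ℝ) : ℝ :=
  (P 0).2 + ∑ i : Fin m,
    ((P i.succ).2 - (P i.castSucc).2) / ((P i.succ).1 - (P i.castSucc).1) *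
      (min (max x (P i.castSucc).1) (P i.succ).1 - (P i.castSucc).1)

/-- On each segment, `connectPoints P` is the linear interpolation between the end points. -/
theorem connectPoints_eq_of_mem_Icc {m : ℕ} (P : Fin (m + 1) → ℝ × ℝ)
    (hP : StrictMono fun i => (P i).1) (j : Fin m) (x : ℝ)
    (hx : x ∈ Set.Icc (P j.castSucc).1 (P j.succ).1) :
    connectPoints P x = (P j.castSucc).2 +
      ((P j.succ).2 - (P j.castSucc).2) / ((P j.succ).1 - (P j.castSucc).1) *
        (x - (P j.castSucc).1) := by
  have hle : ∀ a b : Fin (m + 1), a ≤ b → (P a).1 ≤ (P b).1 := fun a b h => hP.monotone h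
  have key : ∀ k : Fin (m + 1), (P k).2 = (P 0).2 + ∑ i : Fin m,
      if i.castSucc < k then (P i.succ).2 - (P i.castSucc).2 else 0 := by
    intro k
    induction k using Fin.induction with
    | zero => simp
    | succ k ih =>
      have h1 : ∀ i : Fin m, (if i.castSucc < k.succ then (P i.succ).2 - (P i.castSucc).2 else 0) =
          (if i.castSucc < k.castSucc then (P i.succ).2 - (P i.castSucc).2 else 0) +
          (if i = k then (P i.succ).2 - (P i.castSucc).2 else 0) := by
        intro i
        rcases lt_trichotomy i k with h | h | h
        · have h2 : i.castSucc < k.succ := by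
            have := Fin.lt_def.1 h
            rw [Fin.lt_def]; simp only [Fin.val_castSucc, Fin.val_succ]; omega
          simp [h2, h, h.ne]
        · subst h; simp [Fin.lt_def]
        · have h2 : ¬ i.castSucc < k.succ := by
            have := Fin.lt_def.1 h
            rw [Fin.lt_def]; simp only [Fin.val_castSucc, Fin.val_succ]; omega
          simp [h2, h.ne', h.le]
      rw [Finset.sum_congr rfl fun i _ => h1 i, Finset.sum_add_distrib, ← add_assoc, ← ih]
      simp
  have single : ∑ i : Fin m, (if i = j then ((P i.succ).2 - (P i.castSucc).2) /
      ((P i.succ).1 - (P i.castSucc).1) * (x - (P i.castSucc).1) else 0) =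
      ((P j.succ).2 - (P j.castSucc).2) / ((P j.succ).1 - (P j.castSucc).1) *
        (x - (P j.castSucc).1) := by simp
  rw [← single, key j.castSucc, connectPoints, add_assoc, ← Finset.sum_add_distrib]
  congr 1
  refine Finset.sum_congr rfl fun i _ => ?_
  have hi : (P i.castSucc).1 < (P i.succ).1 := hP (Fin.castSucc_lt_succ)
  rcases lt_trichotomy i j with h | h | h
  · have h1 : (P i.succ).1 ≤ x :=
      (hle _ _ (by
        have := Fin.lt_def.1 h
        rw [Fin.le_def]; simp only [Fin.val_castSucc, Fin.val_succ]; omega)).trans hx.1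
    rw [max_eq_left (hi.le.trans h1), min_eq_right h1, div_mul_cancel₀ _ (sub_pos.2 hi).ne']
    simp [h, h.ne]
  · subst h
    rw [max_eq_left hx.1, min_eq_left hx.2]
    simp
  · have h1 : x ≤ (P i.castSucc).1 :=
      hx.2.trans (hle _ _ (by
        have := Fin.lt_def.1 h
        rw [Fin.le_def]; simp only [Fin.val_castSucc, Fin.val_succ]; omega))
    rw [max_eq_right h1, min_eq_left hi.le]
    simp [h.ne', h.le]

/-- The piecewise-linear under-estimator `g` of `f` on `[ξ₀, ξₙ]` determined by the linearization
points `ξ`. -/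
noncomputable def plUnderEstimator {n : ℕ} (f : ℝ → ℝ) (ξ : Fin (n + 1) → ℝ) : ℝ → ℝ :=
  connectPoints (breakpoints f ξ)

/-- The relaxation `U*_f(ξ) = S*_g(ξ₀, ξₙ)`, with `g` the piecewise-linear under-estimator of `f`
determined by `ξ`. -/
noncomputable def plPerspectiveRelaxation {n : ℕ} (f : ℝ → ℝ) (ξ : Fin (n + 1) → ℝ) :
    Set (ℝ × ℝ × ℝ) :=
  perspectiveRelaxation (plUnderEstimator f ξ) (ξ 0) (ξ (Fin.last n))

/-- The relaxation `U*_p(ξ)`, for the power function `f(x) = x ^ p`. -/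
noncomputable def powerRelaxation {n : ℕ} (p : ℝ) (ξ : Fin (n + 1) → ℝ) : Set (ℝ × ℝ × ℝ) :=
  plPerspectiveRelaxation (fun x : ℝ => x ^ p) ξ

/-- The vectors of linearization points `ℓ = ξ₀ < ξ₁ < ⋯ < ξₙ₋₁ < ξₙ = u`. -/
def linearizationPoints (n : ℕ) (ℓ u : ℝ) : Set (Fin (n + 1) → ℝ) :=
  {ξ | ξ 0 = ℓ ∧ ξ (Fin.last n) = u ∧ StrictMono ξ}

/-! Write f(x) = x^p. The under-estimator g is the upper envelope of the tangents at the ξ_i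
(`plUnderEstimator_eq_tangentEnvelope`). Up to a null set the relaxation is a cone of height 1 over
the region between g and the chord, so its volume is a third of that area. The chord does not depend
on ξ, so the problem is to maximize ∫ g (`volume_plPerspectiveRelaxation_le_iff`).

A maximizer exists among weakly increasing vectors by compactness, and it is strictly increasing
because coinciding points waste a tangent (`exists_isMaxOn_integral_tangentEnvelope`). At a
maximizer every interior ξ_j is the midpoint of its two adjacent break points
(`midpoint_of_isMaxOn`).

These equations have one solution (`eq_of_stationary`). By homogeneity of x^p they are scale
invariant, hence constrain only the ratios ξ_{i+1}/ξ_i, and convexity makes a larger ratio force a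
larger next ratio. Of two solutions, the one with the larger ξ_1 thus has all ratios at least as
large; going back from the common end point u, all its points are at most those of the other,
including ξ_1. So the two agree. -/

open Set

/-! ### Tangent lines and the abscissae where they cross -/

/-- The tangent line of `f` at `a`, as a function of `x`. -/
noncomputable def tangentLine (f : ℝ → ℝ) (a x : ℝ) : ℝ := f a + deriv f a * (x - a)

/-- On `D`, the graph of `f` lies strictly above each of its tangent lines, except at the point
of tangency. -/
def AboveTangents (f : ℝ → ℝ) (D : Set ℝ) : Prop :=
  ∀ a ∈ D, ∀ x ∈ D, x ≠ a → tangentLine f a x < f x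

@[simp] theorem tangentLine_self (f : ℝ → ℝ) (a : ℝ) : tangentLine f a a = f a := by
  simp [tangentLine]

namespace AboveTangents

variable {f : ℝ → ℝ} {D : Set ℝ} {a b c x : ℝ}

theorem tangentLine_le (h : AboveTangents f D) (ha : a ∈ D) (hx : x ∈ D) :
    tangentLine f a x ≤ f x := by
  by_cases hxa : x = a
  · simp [hxa]
  · exact (h a ha x hx hxa).le

theorem deriv_lt (h : AboveTangents f D) (ha : a ∈ D) (hb : b ∈ D) (hab : a < b) :
    deriv f a < deriv f b := by
  have h1 := h a ha b hb hab.ne'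
  have h2 := h b hb a ha hab.ne
  unfold tangentLine at h1 h2
  nlinarith

/-- An affine function is its slope times the distance to its zero. The slope here is positive, so
comparing two tangents at `x` amounts to locating `x` relative to their crossing. -/
theorem tangentLine_sub (h : AboveTangents f D) (ha : a ∈ D) (hb : b ∈ D) (hab : a < b) (x : ℝ) :
    tangentLine f b x - tangentLine f a x =
      (deriv f b - deriv f a) * (x - tangentAbscissa f a b) := by
  have h1 : deriv f a - deriv f b ≠ 0 := (sub_neg.2 (h.deriv_lt ha hb hab)).ne
  unfold tangentLine tangentAbscissa
  field_simp
  ring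

theorem tangentLine_le_iff (h : AboveTangents f D) (ha : a ∈ D) (hb : b ∈ D) (hab : a < b) :
    tangentLine f b x ≤ tangentLine f a x ↔ x ≤ tangentAbscissa f a b := by
  have h1 := h.tangentLine_sub ha hb hab x
  have h2 := sub_pos.2 (h.deriv_lt ha hb hab)
  constructor
  · intro hle
    by_contra! hlt
    nlinarith
  · intro hle
    nlinarith

theorem tangentLine_lt_iff (h : AboveTangents f D) (ha : a ∈ D) (hb : b ∈ D) (hab : a < b) :
    tangentLine f b x < tangentLine f a x ↔ x < tangentAbscissa f a b := by
  have h1 := h.tangentLine_sub ha hb hab x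
  have h2 := sub_pos.2 (h.deriv_lt ha hb hab)
  constructor
  · intro hlt
    by_contra! hle
    nlinarith
  · intro hlt
    nlinarith

theorem lt_tangentAbscissa (h : AboveTangents f D) (ha : a ∈ D) (hb : b ∈ D) (hab : a < b) :
    a < tangentAbscissa f a b := by
  rw [← h.tangentLine_lt_iff ha hb hab, tangentLine_self]
  exact h b hb a ha hab.ne

theorem tangentAbscissa_lt (h : AboveTangents f D) (ha : a ∈ D) (hb : b ∈ D) (hab : a < b) :
    tangentAbscissa f a b < b := by
  rw [← not_le, ← h.tangentLine_le_iff ha hb hab, tangentLine_self, not_le]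
  exact h a ha b hb hab.ne'

theorem tangentLine_tangentAbscissa (h : AboveTangents f D) (ha : a ∈ D) (hb : b ∈ D)
    (hab : a < b) :
    tangentLine f b (tangentAbscissa f a b) = tangentLine f a (tangentAbscissa f a b) := by
  have h1 := h.tangentLine_sub ha hb hab (tangentAbscissa f a b)
  rwa [sub_self, mul_zero, sub_eq_zero] at h1

/-- At the crossing of the tangents at `a` and `b`, which lies left of `b`, the tangent at `c` is
still below the tangent at `b`, hence below the one at `a`. -/
theorem tangentAbscissa_lt_right (h : AboveTangents f D) (ha : a ∈ D) (hb : b ∈ D) (hc : c ∈ D)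
    (hab : a < b) (hbc : b < c) : tangentAbscissa f a b < tangentAbscissa f a c := by
  rw [← h.tangentLine_lt_iff ha hc (hab.trans hbc), ← h.tangentLine_tangentAbscissa ha hb hab,
    h.tangentLine_lt_iff hb hc hbc]
  exact (h.tangentAbscissa_lt ha hb hab).trans (h.lt_tangentAbscissa hb hc hbc)

theorem tangentAbscissa_lt_left (h : AboveTangents f D) (ha : a ∈ D) (hb : b ∈ D) (hc : c ∈ D)
    (hab : a < b) (hbc : b < c) : tangentAbscissa f a c < tangentAbscissa f b c := by
  rw [← not_le, ← h.tangentLine_le_iff ha hc (hab.trans hbc),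
    h.tangentLine_tangentAbscissa hb hc hbc, h.tangentLine_le_iff ha hb hab, not_le]
  exact (h.tangentAbscissa_lt ha hb hab).trans (h.lt_tangentAbscissa hb hc hbc)

theorem tangentAbscissa_le_right (h : AboveTangents f D) (ha : a ∈ D) (hb : b ∈ D) (hc : c ∈ D)
    (hab : a < b) (hbc : b ≤ c) : tangentAbscissa f a b ≤ tangentAbscissa f a c := by
  rcases hbc.eq_or_lt with rfl | hbc
  · rfl
  · exact (h.tangentAbscissa_lt_right ha hb hc hab hbc).le

theorem tangentAbscissa_le_left (h : AboveTangents f D) (ha : a ∈ D) (hb : b ∈ D) (hc : c ∈ D)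
    (hab : a ≤ b) (hbc : b < c) : tangentAbscissa f a c ≤ tangentAbscissa f b c := by
  rcases hab.eq_or_lt with rfl | hab
  · rfl
  · exact (h.tangentAbscissa_lt_left ha hb hc hab hbc).le

/-- If `m` is the midpoint of the two tangent abscissae next to it, then moving the left
neighbour of `m` to the right moves the right neighbour to the left. -/
theorem neighbour_antitone (h : AboveTangents f D) {a' b' m : ℝ} (ha : a ∈ D) (ha' : a' ∈ D)
    (hb : b ∈ D) (hb' : b' ∈ D) (hm : m ∈ D) (ham' : a' < m) (hmb : m < b)
    (h1 : 2 * m = tangentAbscissa f a m + tangentAbscissa f m b)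
    (h2 : 2 * m = tangentAbscissa f a' m + tangentAbscissa f m b') (haa : a ≤ a') : b' ≤ b := by
  by_contra! hbb
  have h3 := h.tangentAbscissa_lt_right hm hb hb' hmb hbb
  have h4 := h.tangentAbscissa_le_left ha ha' hm haa ham'
  linarith

end AboveTangents

/-! ### The under-estimator as an upper envelope of tangents -/

/-- The upper envelope of the tangent lines of `f` at the points `ξ i`. -/
noncomputable def tangentEnvelope {n : ℕ} (f : ℝ → ℝ) (ξ : Fin (n + 1) → ℝ) (x : ℝ) : ℝ :=
  Finset.univ.sup' Finset.univ_nonempty fun i => tangentLine f (ξ i) x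

section Envelope

variable {n : ℕ} {f : ℝ → ℝ} {ξ : Fin (n + 1) → ℝ} {D : Set ℝ} {x y : ℝ}

theorem tangentLine_le_tangentEnvelope (i : Fin (n + 1)) :
    tangentLine f (ξ i) x ≤ tangentEnvelope f ξ x :=
  Finset.le_sup' (fun i => tangentLine f (ξ i) x) (Finset.mem_univ i)

theorem tangentEnvelope_le_iff : tangentEnvelope f ξ x ≤ y ↔ ∀ i, tangentLine f (ξ i) x ≤ y := by
  simp [tangentEnvelope]

theorem tangentEnvelope_lt_iff : tangentEnvelope f ξ x < y ↔ ∀ i, tangentLine f (ξ i) x < y := by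
  simp [tangentEnvelope]

theorem tangentEnvelope_self (h : AboveTangents f D) (hξ : ∀ i, ξ i ∈ D) (i : Fin (n + 1)) :
    tangentEnvelope f ξ (ξ i) = f (ξ i) := by
  refine le_antisymm (tangentEnvelope_le_iff.2 fun k => h.tangentLine_le (hξ k) (hξ i)) ?_
  simpa using tangentLine_le_tangentEnvelope (f := f) (ξ := ξ) (x := ξ i) i

theorem breakpoints_zero : breakpoints f ξ 0 = (ξ 0, f (ξ 0)) := rfl

theorem breakpoints_last :
    breakpoints f ξ (Fin.last (n + 1)) = (ξ (Fin.last n), f (ξ (Fin.last n))) := by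
  rw [breakpoints, ← Fin.succ_last, Fin.cons_succ, Fin.snoc_last]

theorem breakpoints_castSucc_succ (i : Fin n) :
    breakpoints f ξ i.castSucc.succ = tangentIntersection f (ξ i.castSucc) (ξ i.succ) := by
  rw [breakpoints, Fin.cons_succ, Fin.snoc_castSucc]

/-- Piece `i`, from break point `i` to `i + 1`, lies on the tangent at `ξ i`. For the left end this
is the definition; the right end, treated next, needs that both tangents agree at their crossing. -/
theorem breakpoints_left_snd (i : Fin (n + 1)) :
    (breakpoints f ξ i.castSucc).2 = tangentLine f (ξ i) (breakpoints f ξ i.castSucc).1 := by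
  cases i using Fin.cases with
  | zero => simp [breakpoints_zero]
  | succ i =>
    rw [← Fin.succ_castSucc, breakpoints_castSucc_succ]
    rfl

theorem breakpoints_right_snd (h : AboveTangents f D) (hξ : ∀ i, ξ i ∈ D) (hmono : StrictMono ξ)
    (i : Fin (n + 1)) :
    (breakpoints f ξ i.succ).2 = tangentLine f (ξ i) (breakpoints f ξ i.succ).1 := by
  cases i using Fin.lastCases with
  | last => simp [breakpoints_last]
  | cast i =>
    rw [breakpoints_castSucc_succ]
    exact h.tangentLine_tangentAbscissa (hξ _) (hξ _) (hmono Fin.castSucc_lt_succ)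

theorem breakpoints_left_fst_lt (h : AboveTangents f D) (hξ : ∀ i, ξ i ∈ D) (hmono : StrictMono ξ)
    (i : Fin n) : (breakpoints f ξ i.succ.castSucc).1 < ξ i.succ := by
  rw [← Fin.succ_castSucc, breakpoints_castSucc_succ]
  exact h.tangentAbscissa_lt (hξ _) (hξ _) (hmono Fin.castSucc_lt_succ)

theorem lt_breakpoints_right_fst (h : AboveTangents f D) (hξ : ∀ i, ξ i ∈ D)
    (hmono : StrictMono ξ) (i : Fin n) : ξ i.castSucc < (breakpoints f ξ i.castSucc.succ).1 := by
  rw [breakpoints_castSucc_succ]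
  exact h.lt_tangentAbscissa (hξ _) (hξ _) (hmono Fin.castSucc_lt_succ)

theorem breakpoints_left_fst_le (h : AboveTangents f D) (hξ : ∀ i, ξ i ∈ D) (hmono : StrictMono ξ)
    (i : Fin (n + 1)) : (breakpoints f ξ i.castSucc).1 ≤ ξ i := by
  cases i using Fin.cases with
  | zero => simp [breakpoints_zero]
  | succ i => exact (breakpoints_left_fst_lt h hξ hmono i).le

theorem le_breakpoints_right_fst (h : AboveTangents f D) (hξ : ∀ i, ξ i ∈ D)
    (hmono : StrictMono ξ) (i : Fin (n + 1)) : ξ i ≤ (breakpoints f ξ i.succ).1 := by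
  cases i using Fin.lastCases with
  | last => simp [breakpoints_last]
  | cast i => exact (lt_breakpoints_right_fst h hξ hmono i).le

/-- Each `ξ i` separates the ends of its piece, strictly on at least one side. For `n = 0` both ends
of the only piece would be `ξ 0`. -/
theorem strictMono_breakpoints_fst (h : AboveTangents f D) (hξ : ∀ i, ξ i ∈ D)
    (hmono : StrictMono ξ) (hn : 1 ≤ n) : StrictMono fun i => (breakpoints f ξ i).1 := by
  refine Fin.strictMono_iff_lt_succ.2 fun i => ?_
  cases i using Fin.cases with
  | zero =>
    obtain ⟨m, rfl⟩ : ∃ m, n = m + 1 := ⟨n - 1, by omega⟩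
    exact (breakpoints_left_fst_le h hξ hmono 0).trans_lt
      (lt_breakpoints_right_fst h hξ hmono (0 : Fin (m + 1)))
  | succ i =>
    exact (breakpoints_left_fst_lt h hξ hmono i).trans_le
      (le_breakpoints_right_fst h hξ hmono i.succ)

/-- The tangent line which is on top at `x` is the one between whose break points `x` lies. -/
theorem mem_Icc_breakpoints_of_top (h : AboveTangents f D) (hξ : ∀ i, ξ i ∈ D)
    (hmono : StrictMono ξ) (hx : x ∈ Icc (ξ 0) (ξ (Fin.last n))) {i : Fin (n + 1)}
    (hi : ∀ k, tangentLine f (ξ k) x ≤ tangentLine f (ξ i) x) :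
    x ∈ Icc (breakpoints f ξ i.castSucc).1 (breakpoints f ξ i.succ).1 := by
  constructor
  · cases i using Fin.cases with
    | zero => simpa [breakpoints_zero] using hx.1
    | succ i =>
      rw [← Fin.succ_castSucc, breakpoints_castSucc_succ]
      by_contra! hlt
      exact ((h.tangentLine_lt_iff (hξ _) (hξ _) (hmono Fin.castSucc_lt_succ)).2 hlt).not_ge
        (hi i.castSucc)
  · cases i using Fin.lastCases with
    | last => simpa [breakpoints_last] using hx.2
    | cast i =>
      rw [breakpoints_castSucc_succ]
      exact (h.tangentLine_le_iff (hξ _) (hξ _) (hmono Fin.castSucc_lt_succ)).1 (hi i.succ)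

/-- The piecewise-linear under-estimator is the upper envelope of the tangent lines. -/
theorem plUnderEstimator_eq_tangentEnvelope (h : AboveTangents f D) (hξ : ∀ i, ξ i ∈ D)
    (hmono : StrictMono ξ) (hn : 1 ≤ n) (hx : x ∈ Icc (ξ 0) (ξ (Fin.last n))) :
    plUnderEstimator f ξ x = tangentEnvelope f ξ x := by
  obtain ⟨i, -, hi⟩ := Finset.exists_mem_eq_sup' Finset.univ_nonempty
    fun i => tangentLine f (ξ i) x
  change tangentEnvelope f ξ x = _ at hi
  have hmem := mem_Icc_breakpoints_of_top h hξ hmono hx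
    fun k => (tangentLine_le_tangentEnvelope k).trans hi.le
  have hσ := strictMono_breakpoints_fst h hξ hmono hn
  have hlt : (breakpoints f ξ i.castSucc).1 < (breakpoints f ξ i.succ).1 :=
    hσ Fin.castSucc_lt_succ
  rw [plUnderEstimator, connectPoints_eq_of_mem_Icc _ hσ i x hmem, hi,
    breakpoints_right_snd h hξ hmono, breakpoints_left_snd]
  have h0 := (sub_pos.2 hlt).ne'
  unfold tangentLine
  field_simp
  ring

end Envelope

/-! ### The volume of the relaxation -/

section Volume

open MeasureTheory

/-- The slice at height `z` is `z • A`, of area `z ^ 2` times that of `A`, and `z ^ 2` integrates to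
1/3 over the unit interval. -/
theorem volume_truncatedCone {A : Set (ℝ × ℝ)} (hA : MeasurableSet A) :
    volume {q : ℝ × ℝ × ℝ | q.2.2 ∈ Ioc (0 : ℝ) 1 ∧ (q.1 / q.2.2, q.2.1 / q.2.2) ∈ A} =
      ENNReal.ofReal (1 / 3) * volume A := by
  set T : Set ((ℝ × ℝ) × ℝ) := {w | w.2 ∈ Ioc (0 : ℝ) 1 ∧ (w.1.1 / w.2, w.1.2 / w.2) ∈ A}
    with hTdef
  have hT : MeasurableSet T := by
    have h1 : MeasurableSet {w : (ℝ × ℝ) × ℝ | w.2 ∈ Ioc (0 : ℝ) 1} :=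
      measurable_snd measurableSet_Ioc
    have h2 : Measurable fun w : (ℝ × ℝ) × ℝ => (w.1.1 / w.2, w.1.2 / w.2) := by fun_prop
    exact h1.inter (h2 hA)
  have hmp := (volume_preserving_prodAssoc (α₁ := ℝ) (β₁ := ℝ) (γ₁ := ℝ)).symm
  have h1 := hmp.measure_preimage hT.nullMeasurableSet
  have h2 : ∀ z : ℝ, volume ((fun w : ℝ × ℝ => (w, z)) ⁻¹' T) =
      (Ioc (0 : ℝ) 1).indicator (fun z => ENNReal.ofReal (z ^ 2) * volume A) z := by
    intro z
    by_cases hz : z ∈ Ioc (0 : ℝ) 1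
    · have h3 : (fun w : ℝ × ℝ => (w, z)) ⁻¹' T = (z⁻¹ • · : ℝ × ℝ → ℝ × ℝ) ⁻¹' A := by
        ext w
        have h4 : z⁻¹ • w = (w.1 / z, w.2 / z) := by
          ext <;> simp [div_eq_inv_mul]
        simp only [hTdef, mem_preimage, mem_ofPred_eq, h4, hz, true_and]
      rw [indicator_of_mem hz, h3, Measure.addHaar_preimage_smul _ (inv_ne_zero hz.1.ne')]
      congr 2
      simp [abs_of_nonneg (sq_nonneg z)]
    · rw [indicator_of_notMem hz]
      have h3 : (fun w : ℝ × ℝ => (w, z)) ⁻¹' T = ∅ := by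
        ext w
        simp only [hTdef, mem_preimage, mem_ofPred_eq, hz, false_and, mem_empty_iff_false]
      rw [h3, measure_empty]
  have h5 : ∫⁻ z in Ioc (0 : ℝ) 1, ENNReal.ofReal (z ^ 2) = ENNReal.ofReal (1 / 3) := by
    rw [← ofReal_integral_eq_lintegral_ofReal, ← intervalIntegral.integral_of_le zero_le_one,
      integral_pow]
    · norm_num
    · exact (continuous_pow 2).integrableOn_Ioc
    · exact Filter.Eventually.of_forall fun z => sq_nonneg z
  refine Eq.trans h1 ?_
  rw [Measure.volume_eq_prod, Measure.prod_apply_symm hT, lintegral_congr h2,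
    lintegral_indicator measurableSet_Ioc, lintegral_mul_const _ (by fun_prop), h5]

theorem measurableSet_between {g k : ℝ → ℝ} {ℓ u : ℝ} (hg : Continuous g) (hk : Continuous k) :
    MeasurableSet {w : ℝ × ℝ | w.1 ∈ Icc ℓ u ∧ g w.1 ≤ w.2 ∧ w.2 ≤ k w.1} :=
  (measurable_fst measurableSet_Icc).inter
    ((measurableSet_le (hg.comp continuous_fst).measurable measurable_snd).inter
      (measurableSet_le measurable_snd (hk.comp continuous_fst).measurable))

theorem volume_between {g k : ℝ → ℝ} {ℓ u : ℝ} (hℓu : ℓ ≤ u) (hg : Continuous g)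
    (hk : Continuous k) (hgk : ∀ x ∈ Icc ℓ u, g x ≤ k x) :
    volume {w : ℝ × ℝ | w.1 ∈ Icc ℓ u ∧ g w.1 ≤ w.2 ∧ w.2 ≤ k w.1} =
      ENNReal.ofReal (∫ x in ℓ..u, (k x - g x)) := by
  have h1 : ∀ x : ℝ, volume (Prod.mk x ⁻¹' {w : ℝ × ℝ | w.1 ∈ Icc ℓ u ∧ g w.1 ≤ w.2 ∧ w.2 ≤ k w.1})
      = (Icc ℓ u).indicator (fun x => ENNReal.ofReal (k x - g x)) x := by
    intro x
    by_cases hx : x ∈ Icc ℓ u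
    · rw [indicator_of_mem hx, ← Real.volume_Icc]
      congr 1
      ext y
      exact and_iff_right hx
    · rw [indicator_of_notMem hx]
      convert! measure_empty (μ := (volume : Measure ℝ))
      ext y
      simp only [mem_preimage, mem_ofPred_eq, hx, false_and, mem_empty_iff_false]
  rw [Measure.volume_eq_prod, Measure.prod_apply (measurableSet_between hg hk), lintegral_congr h1,
    lintegral_indicator measurableSet_Icc, intervalIntegral.integral_of_le hℓu,
    ← integral_Icc_eq_integral_Ioc, ofReal_integral_eq_lintegral_ofReal]
  · exact (hk.sub hg).integrableOn_Icc
  · exact (ae_restrict_iff' measurableSet_Icc).2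
      (Filter.Eventually.of_forall fun x hx => sub_nonneg.2 (hgk x hx))

variable {n : ℕ} {f : ℝ → ℝ} {ξ : Fin (n + 1) → ℝ} {ℓ u : ℝ}

theorem continuous_tangentLine (hf : Continuous f) (hf' : Continuous (deriv f)) :
    Continuous fun w : ℝ × ℝ => tangentLine f w.1 w.2 := by
  unfold tangentLine
  fun_prop

theorem continuous_tangentEnvelope (hf : Continuous f) (hf' : Continuous (deriv f)) :
    Continuous fun w : (Fin (n + 1) → ℝ) × ℝ => tangentEnvelope f w.1 w.2 := by
  unfold tangentEnvelope
  refine Continuous.finset_sup'_apply _ fun i _ => ?_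
  exact (continuous_tangentLine hf hf').comp (by fun_prop :
    Continuous fun w : (Fin (n + 1) → ℝ) × ℝ => (w.1 i, w.2))

theorem continuous_tangentEnvelope_right (ξ : Fin (n + 1) → ℝ) :
    Continuous (tangentEnvelope f ξ) := by
  unfold tangentEnvelope
  refine Continuous.finset_sup'_apply _ fun i _ => ?_
  unfold tangentLine
  fun_prop

/-- The chord of `f` over `[ℓ, u]`. -/
noncomputable def chord (f : ℝ → ℝ) (ℓ u x : ℝ) : ℝ :=
  f ℓ - (f u - f ℓ) / (u - ℓ) * ℓ + (f u - f ℓ) / (u - ℓ) * x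

/-- Both sides are affine in `x`, so it suffices to compare them at `ℓ` and `u`. -/
theorem tangentLine_le_chord (h : AboveTangents f (Icc ℓ u)) (hℓu : ℓ < u) {a x : ℝ}
    (ha : a ∈ Icc ℓ u) (hx : x ∈ Icc ℓ u) : tangentLine f a x ≤ chord f ℓ u x := by
  have h1 := h.tangentLine_le ha (left_mem_Icc.2 hℓu.le)
  have h2 := h.tangentLine_le ha (right_mem_Icc.2 hℓu.le)
  have h0 := sub_pos.2 hℓu
  have h3 : chord f ℓ u x = (f ℓ * (u - x) + f u * (x - ℓ)) / (u - ℓ) := by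
    unfold chord
    field_simp
    ring
  have h4 : tangentLine f a x =
      (tangentLine f a ℓ * (u - x) + tangentLine f a u * (x - ℓ)) / (u - ℓ) := by
    unfold tangentLine
    field_simp
    ring
  rw [h3, h4]
  have h5 := sub_nonneg.2 hx.1
  have h6 := sub_nonneg.2 hx.2
  gcongr

theorem linearizationPoints_mem_Icc (hξ : ξ ∈ linearizationPoints n ℓ u) (i : Fin (n + 1)) :
    ξ i ∈ Icc ℓ u := by
  obtain ⟨rfl, rfl, hm⟩ := hξ
  exact ⟨hm.monotone (Fin.zero_le i), hm.monotone (Fin.le_last i)⟩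

theorem tangentLine_perspective {a x z : ℝ} (hz : z ≠ 0) :
    z * tangentLine f a (x / z) = (f a - deriv f a * a) * z + deriv f a * x := by
  unfold tangentLine
  field_simp
  ring

/-- Linearizes the perspective constraint; convexity of the truncated cone is then immediate. -/
theorem mul_tangentEnvelope_le_iff {x y z : ℝ} (hz : 0 < z) :
    z * tangentEnvelope f ξ (x / z) ≤ y ↔
      ∀ i, (f (ξ i) - deriv f (ξ i) * ξ i) * z + deriv f (ξ i) * x ≤ y := by
  rw [← le_div_iff₀' hz, tangentEnvelope_le_iff]
  refine forall_congr' fun i => ?_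
  rw [le_div_iff₀' hz, tangentLine_perspective hz.ne']

/-- The generating set is already convex, and the frontier of a convex set is null, so neither the
convex hull nor the closure changes the volume. -/
theorem volume_plPerspectiveRelaxation (h : AboveTangents f (Icc ℓ u)) (hℓu : ℓ < u)
    (hf0 : 0 ≤ f ℓ) (hf1 : 0 ≤ deriv f ℓ) (hn : 1 ≤ n) (hξ : ξ ∈ linearizationPoints n ℓ u) :
    volume (plPerspectiveRelaxation f ξ) = ENNReal.ofReal (1 / 3) *
      ENNReal.ofReal ((∫ x in ℓ..u, chord f ℓ u x) - ∫ x in ℓ..u, tangentEnvelope f ξ x) := by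
  have hmem := linearizationPoints_mem_Icc hξ
  obtain ⟨h0, hlast, hmono⟩ := hξ
  have henv : ∀ x ∈ Icc ℓ u, plUnderEstimator f ξ x = tangentEnvelope f ξ x := fun x hx =>
    plUnderEstimator_eq_tangentEnvelope h hmem hmono hn (by rwa [h0, hlast])
  have hgℓ : plUnderEstimator f ξ ℓ = f ℓ := by
    rw [henv _ (left_mem_Icc.2 hℓu.le), ← h0, tangentEnvelope_self h hmem]
  have hgu : plUnderEstimator f ξ u = f u := by
    rw [henv _ (right_mem_Icc.2 hℓu.le), ← hlast, tangentEnvelope_self h hmem]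
  have hdiv : ∀ {x z : ℝ}, 0 < z → (x / z ∈ Icc ℓ u ↔ x ≤ u * z ∧ ℓ * z ≤ x) := by
    intro x z hz
    rw [mem_Icc, le_div_iff₀ hz, div_le_iff₀ hz, and_comm]
  -- The constraint `0 ≤ y` is redundant: the tangent at `ξ 0 = ℓ` gives `y ≥ f ℓ * z + deriv f ℓ *
  -- (x - ℓ * z)`.
  have hnonneg : ∀ {x y z : ℝ}, 0 < z → ℓ * z ≤ x →
      z * tangentEnvelope f ξ (x / z) ≤ y → 0 ≤ y := by
    intro x y z hz hx hy
    have h1 := (mul_tangentEnvelope_le_iff hz).1 hy 0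
    rw [h0] at h1
    have h2 := mul_nonneg hf0 hz.le
    have h3 := mul_nonneg hf1 (sub_nonneg.2 hx)
    linarith
  set S : Set (ℝ × ℝ × ℝ) := {q | q.2.2 ∈ Ioc (0 : ℝ) 1 ∧ (q.1 / q.2.2, q.2.1 / q.2.2) ∈
    {w : ℝ × ℝ | w.1 ∈ Icc ℓ u ∧ tangentEnvelope f ξ w.1 ≤ w.2 ∧ w.2 ≤ chord f ℓ u w.1}} with hS
  have hSmem : ∀ x y z : ℝ, (x, y, z) ∈ S ↔ 0 < z ∧ z ≤ 1 ∧ x ≤ u * z ∧ ℓ * z ≤ x ∧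
      (∀ i, (f (ξ i) - deriv f (ξ i) * ξ i) * z + deriv f (ξ i) * x ≤ y) ∧
      y ≤ (f ℓ - (f u - f ℓ) / (u - ℓ) * ℓ) * z + (f u - f ℓ) / (u - ℓ) * x := by
    intro x y z
    simp only [hS, mem_ofPred_eq, mem_Ioc, and_assoc]
    refine and_congr_right fun hz => and_congr_right fun _ => ?_
    have h1 : z * chord f ℓ u (x / z) =
        (f ℓ - (f u - f ℓ) / (u - ℓ) * ℓ) * z + (f u - f ℓ) / (u - ℓ) * x := by
      unfold chord
      field_simp
    rw [hdiv hz, le_div_iff₀' hz, mul_tangentEnvelope_le_iff hz, div_le_iff₀' hz, h1, and_assoc]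
  have hSeq : plPerspectiveRelaxation f ξ = closure (convexHull ℝ S) := by
    rw [plPerspectiveRelaxation, perspectiveRelaxation, h0, hlast, hgℓ, hgu]
    congr 2
    ext ⟨x, y, z⟩
    rw [hSmem]
    constructor
    · rintro ⟨x, y, z, hq, h1, h2, h3, h4, h5, h6, h7⟩
      obtain ⟨rfl, rfl, rfl⟩ : _ = x ∧ _ = y ∧ _ = z := by simpa using hq
      rw [henv _ ((hdiv h6).2 ⟨h3, h4⟩), mul_tangentEnvelope_le_iff h6] at h2
      exact ⟨h6, h5, h3, h4, h2, h1⟩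
    · rintro ⟨h6, h5, h3, h4, h2, h1⟩
      rw [← mul_tangentEnvelope_le_iff h6] at h2
      refine ⟨x, y, z, rfl, h1, ?_, h3, h4, h5, h6, hnonneg h6 h4 h2⟩
      rwa [henv _ ((hdiv h6).2 ⟨h3, h4⟩)]
  have hconv : Convex ℝ S := by
    rw [convex_iff_forall_pos]
    rintro ⟨x, y, z⟩ h1 ⟨x', y', z'⟩ h2 a b ha hb hab
    rw [hSmem] at h1 h2
    simp only [Prod.smul_mk, Prod.mk_add_mk, smul_eq_mul]
    rw [hSmem]
    obtain ⟨p1, p2, p3, p4, p5, p6⟩ := h1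
    obtain ⟨q1, q2, q3, q4, q5, q6⟩ := h2
    refine ⟨by positivity, ?_, ?_, ?_, fun i => ?_, ?_⟩
    · linarith [mul_le_mul_of_nonneg_left p2 ha.le, mul_le_mul_of_nonneg_left q2 hb.le]
    · linarith [mul_le_mul_of_nonneg_left p3 ha.le, mul_le_mul_of_nonneg_left q3 hb.le]
    · linarith [mul_le_mul_of_nonneg_left p4 ha.le, mul_le_mul_of_nonneg_left q4 hb.le]
    · linarith [mul_le_mul_of_nonneg_left (p5 i) ha.le, mul_le_mul_of_nonneg_left (q5 i) hb.le]
    · linarith [mul_le_mul_of_nonneg_left p6 ha.le, mul_le_mul_of_nonneg_left q6 hb.le]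
  have hcont : Continuous (chord f ℓ u) := by
    unfold chord
    fun_prop
  have hcenv := continuous_tangentEnvelope_right (f := f) ξ
  have hHaar : (volume : Measure (ℝ × ℝ × ℝ)).IsAddHaarMeasure :=
    Measure.prod.instIsAddHaarMeasure (volume : Measure ℝ) (volume : Measure (ℝ × ℝ))
  rw [hSeq, hconv.convexHull_eq, closure_eq_self_union_frontier,
    measure_congr (union_ae_eq_left_of_ae_eq_empty (ae_eq_empty.2 (hconv.addHaar_frontier volume))), hS,
    volume_truncatedCone (measurableSet_between hcenv hcont),
    volume_between hℓu.le hcenv hcont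
      fun x hx => tangentEnvelope_le_iff.2 fun i => tangentLine_le_chord h hℓu (hmem i) hx,
    intervalIntegral.integral_sub (hcont.intervalIntegrable _ _) (hcenv.intervalIntegrable _ _)]

theorem integral_tangentEnvelope_le (h : AboveTangents f (Icc ℓ u)) (hℓu : ℓ < u)
    (hξ : ξ ∈ linearizationPoints n ℓ u) :
    ∫ x in ℓ..u, tangentEnvelope f ξ x ≤ ∫ x in ℓ..u, chord f ℓ u x := by
  have hcont : Continuous (chord f ℓ u) := by
    unfold chord
    fun_prop
  exact intervalIntegral.integral_mono_on hℓu.le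
    ((continuous_tangentEnvelope_right ξ).intervalIntegrable _ _) (hcont.intervalIntegrable _ _)
    fun x hx => tangentEnvelope_le_iff.2 fun i =>
      tangentLine_le_chord h hℓu (linearizationPoints_mem_Icc hξ i) hx

/-- Minimizing the volume of the relaxation is maximizing the integral of the under-estimator. -/
theorem volume_plPerspectiveRelaxation_le_iff (h : AboveTangents f (Icc ℓ u)) (hℓu : ℓ < u)
    (hf0 : 0 ≤ f ℓ) (hf1 : 0 ≤ deriv f ℓ) (hn : 1 ≤ n) (hξ : ξ ∈ linearizationPoints n ℓ u)
    {η : Fin (n + 1) → ℝ} (hη : η ∈ linearizationPoints n ℓ u) :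
    volume (plPerspectiveRelaxation f ξ) ≤ volume (plPerspectiveRelaxation f η) ↔
      ∫ x in ℓ..u, tangentEnvelope f η x ≤ ∫ x in ℓ..u, tangentEnvelope f ξ x := by
  rw [volume_plPerspectiveRelaxation h hℓu hf0 hf1 hn hξ,
    volume_plPerspectiveRelaxation h hℓu hf0 hf1 hn hη,
    ENNReal.mul_le_mul_iff_right (by simp) ENNReal.ofReal_ne_top,
    -- Truncation by `ENNReal.ofReal` loses nothing, since the chord dominates the envelope.
    ENNReal.ofReal_le_ofReal_iff (sub_nonneg.2 (integral_tangentEnvelope_le h hℓu hη)),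
    sub_le_sub_iff_left]

end Volume

/-! ### Existence of a maximizer and its stationarity -/

section Optimization

variable {n : ℕ} {f : ℝ → ℝ} {ξ : Fin (n + 1) → ℝ} {ℓ u : ℝ}

theorem monotone_update {j : Fin (n + 1)} {c : ℝ} (hξ : Monotone ξ) (h1 : ∀ i < j, ξ i ≤ c)
    (h2 : ∀ i, j < i → c ≤ ξ i) : Monotone (Function.update ξ j c) := by
  intro a b hab
  rcases eq_or_ne a j with rfl | ha <;> rcases eq_or_ne b a with rfl | hb
  · rfl
  · simpa [hb] using h2 b (lt_of_le_of_ne hab hb.symm)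
  · rfl
  · rcases eq_or_ne b j with rfl | hbj
    · simpa [ha] using h1 a (lt_of_le_of_ne hab ha)
    · simpa [ha, hbj] using hξ hab

theorem strictMono_update {j : Fin (n + 1)} {c : ℝ} (hξ : StrictMono ξ) (h1 : ∀ i < j, ξ i < c)
    (h2 : ∀ i, j < i → c < ξ i) : StrictMono (Function.update ξ j c) := by
  intro a b hab
  rcases eq_or_ne a j with rfl | ha
  · simpa [hab.ne'] using h2 b hab
  · rcases eq_or_ne b j with rfl | hbj
    · simpa [ha] using h1 a hab
    · simpa [ha, hbj] using hξ hab

/-- The monotone vectors with end points `ℓ` and `u`: the closure of `linearizationPoints`. -/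
def weakLinearizationPoints (n : ℕ) (ℓ u : ℝ) : Set (Fin (n + 1) → ℝ) :=
  {ξ | ξ 0 = ℓ ∧ ξ (Fin.last n) = u ∧ Monotone ξ}

theorem weakLinearizationPoints_mem_Icc (hξ : ξ ∈ weakLinearizationPoints n ℓ u)
    (i : Fin (n + 1)) : ξ i ∈ Icc ℓ u := by
  obtain ⟨rfl, rfl, hm⟩ := hξ
  exact ⟨hm (Fin.zero_le i), hm (Fin.le_last i)⟩

theorem isCompact_weakLinearizationPoints (n : ℕ) (ℓ u : ℝ) :
    IsCompact (weakLinearizationPoints n ℓ u) := by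
  refine (isCompact_univ_pi fun _ : Fin (n + 1) => isCompact_Icc (a := ℓ) (b := u)).of_isClosed_subset
    ?_ fun ξ hξ i _ => weakLinearizationPoints_mem_Icc hξ i
  exact (isClosed_eq (continuous_apply _) continuous_const).inter
    ((isClosed_eq (continuous_apply _) continuous_const).inter isClosed_monotone)

theorem nonempty_linearizationPoints (hn : 1 ≤ n) (hℓu : ℓ < u) :
    (linearizationPoints n ℓ u).Nonempty := by
  have h0 : (0 : ℝ) < n := by exact_mod_cast hn
  refine ⟨fun i => ℓ + (u - ℓ) / n * (i : ℕ), by simp, ?_, ?_⟩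
  · simp only [Fin.val_last]
    field_simp
    ring
  · intro a b hab
    have h1 : ((a : ℕ) : ℝ) < (b : ℕ) := by exact_mod_cast hab
    have h2 : 0 < (u - ℓ) / n := div_pos (sub_pos.2 hℓu) h0
    simp only
    gcongr

/-- In a degenerate vector of linearization points, one of two coinciding points can be moved to a
new place. -/
theorem exists_move_of_not_strictMono (hℓu : ℓ < u) (hξ : ξ ∈ weakLinearizationPoints n ℓ u)
    (hns : ¬ StrictMono ξ) : ∃ (j k : Fin (n + 1)) (c : ℝ), k ≠ j ∧ ξ k = ξ j ∧ (∀ i, ξ i ≠ c) ∧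
      Function.update ξ j c ∈ weakLinearizationPoints n ℓ u := by
  obtain ⟨h0, hlast, hmono⟩ := hξ
  obtain ⟨a, b, hab, heq⟩ : ∃ a b, a < b ∧ ξ a = ξ b := by
    by_contra! hne
    exact hns fun a b hab => lt_of_le_of_ne (hmono hab.le) (hne a b hab)
  -- If the repeated value is below `u`, its last index moves up, halfway to the next value.
  -- Otherwise the value is `u > ℓ`, and its first index moves down, halfway to the previous value.
  -- Neither end point is moved.
  by_cases hu : ξ b < u
  · obtain ⟨j, hj, hjmax⟩ := (Finset.univ.filter fun i => ξ i = ξ b).exists_max_image id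
      ⟨b, by simp⟩
    simp only [Finset.mem_filter, Finset.mem_univ, true_and, id] at hj hjmax
    have hbj : b ≤ j := hjmax b rfl
    have hjlast : j ≠ Fin.last n := by
      rintro rfl
      rw [← hj, hlast] at hu
      exact hu.ne rfl
    have hjn : (j : ℕ) < n := by
      have := Fin.val_lt_last hjlast
      simpa using this
    set k : Fin (n + 1) := ⟨j + 1, by omega⟩ with hk
    have hjk : j < k := by simp [Fin.lt_def, hk]
    have hlt : ξ j < ξ k := lt_of_le_of_ne (hmono hjk.le) fun h => by
      exact (hjmax k (by rw [← h, hj])).not_gt hjk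
    have h1 : ∀ i ≤ j, ξ i < (ξ j + ξ k) / 2 := fun i hi => by linarith [hmono hi]
    have h2 : ∀ i, j < i → (ξ j + ξ k) / 2 < ξ i := fun i hi => by
      have : k ≤ i := by
        rw [Fin.le_def, hk]
        exact hi
      linarith [hmono this]
    have hj0 : (0 : Fin (n + 1)) ≠ j := ((Fin.zero_le a).trans_lt (hab.trans_le hbj)).ne
    refine ⟨j, a, (ξ j + ξ k) / 2, (hab.trans_le hbj).ne, heq.trans hj.symm, fun i => ?_,
      by simpa [hj0] using h0, by simpa [hjlast.symm] using hlast,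
      monotone_update hmono (fun i hi => (h1 i hi.le).le) fun i hi => (h2 i hi).le⟩
    rcases le_or_gt i j with hi | hi
    · exact (h1 i hi).ne
    · exact (h2 i hi).ne'
  · have hℓa : ℓ < ξ a := by
      rw [heq]
      exact hℓu.trans_le (not_lt.1 hu)
    obtain ⟨j, hj, hjmin⟩ := (Finset.univ.filter fun i => ξ i = ξ a).exists_min_image id
      ⟨a, by simp⟩
    simp only [Finset.mem_filter, Finset.mem_univ, true_and, id] at hj hjmin
    have hja : j ≤ a := hjmin a rfl
    have hj0 : j ≠ 0 := by
      rintro rfl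
      rw [← hj, h0] at hℓa
      exact hℓa.ne rfl
    have hjpos : 0 < (j : ℕ) := Nat.pos_of_ne_zero fun h => hj0 (Fin.ext h)
    set k : Fin (n + 1) := ⟨j - 1, by omega⟩ with hk
    have hkj : k < j := by
      rw [Fin.lt_def, hk]
      exact Nat.sub_lt hjpos one_pos
    have hlt : ξ k < ξ j := lt_of_le_of_ne (hmono hkj.le) fun h => by
      exact (hjmin k (by rw [h, hj])).not_gt hkj
    have h1 : ∀ i < j, ξ i < (ξ k + ξ j) / 2 := fun i hi => by
      have : i ≤ k := by
        rw [Fin.le_def, hk]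
        exact Nat.le_sub_one_of_lt hi
      linarith [hmono this]
    have h2 : ∀ i, j ≤ i → (ξ k + ξ j) / 2 < ξ i := fun i hi => by linarith [hmono hi]
    have hjlast : Fin.last n ≠ j := ((hja.trans_lt hab).trans_le (Fin.le_last b)).ne'
    refine ⟨j, b, (ξ k + ξ j) / 2, (hja.trans_lt hab).ne', heq.symm.trans hj.symm, fun i => ?_,
      by simpa [hj0.symm] using h0, by simpa [hjlast] using hlast,
      monotone_update hmono (fun i hi => (h1 i hi).le) fun i hi => (h2 i hi.le).le⟩
    rcases lt_or_ge i j with hi | hi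
    · exact (h1 i hi).ne
    · exact (h2 i hi).ne'

/-- The tangent given up is still supplied by `k`, so the envelope drops nowhere; at `c` it was
strictly below `f c` and now reaches it. Continuity makes the gain in the integral strict. -/
theorem integral_tangentEnvelope_lt_of_move (h : AboveTangents f (Icc ℓ u)) (hℓu : ℓ < u)
    (hξ : ∀ i, ξ i ∈ Icc ℓ u) {j k : Fin (n + 1)} {c : ℝ} (hkj : k ≠ j) (heq : ξ k = ξ j)
    (hc : c ∈ Icc ℓ u) (hcξ : ∀ i, ξ i ≠ c) :
    ∫ x in ℓ..u, tangentEnvelope f ξ x <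
      ∫ x in ℓ..u, tangentEnvelope f (Function.update ξ j c) x := by
  refine intervalIntegral.integral_lt_integral_of_continuousOn_of_le_of_exists_lt hℓu
    (continuous_tangentEnvelope_right _).continuousOn
    (continuous_tangentEnvelope_right _).continuousOn (fun x _ => ?_) ⟨c, hc, ?_⟩
  · have key : ∀ i ≠ j, tangentLine f (ξ i) x ≤ tangentEnvelope f (Function.update ξ j c) x := by
      intro i hi
      have := tangentLine_le_tangentEnvelope (f := f) (ξ := Function.update ξ j c) (x := x) i
      rwa [Function.update_of_ne hi] at this
    refine tangentEnvelope_le_iff.2 fun i => ?_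
    rcases eq_or_ne i j with rfl | hi
    · rw [← heq]
      exact key k hkj
    · exact key i hi
  · have h1 : tangentEnvelope f ξ c < f c :=
      tangentEnvelope_lt_iff.2 fun i => h _ (hξ i) c hc (hcξ i).symm
    have h2 := tangentLine_le_tangentEnvelope (f := f) (ξ := Function.update ξ j c) (x := c) j
    rw [Function.update_self, tangentLine_self] at h2
    exact h1.trans_le h2

theorem exists_isMaxOn_integral_tangentEnvelope (h : AboveTangents f (Icc ℓ u))
    (hf : Continuous f) (hf' : Continuous (deriv f)) (hℓu : ℓ < u) (hn : 1 ≤ n) :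
    ∃ ξ ∈ linearizationPoints n ℓ u, IsMaxOn
      (fun η : Fin (n + 1) → ℝ => ∫ x in ℓ..u, tangentEnvelope f η x)
      (linearizationPoints n ℓ u) ξ := by
  have hsub : linearizationPoints n ℓ u ⊆ weakLinearizationPoints n ℓ u :=
    fun ξ hξ => ⟨hξ.1, hξ.2.1, hξ.2.2.monotone⟩
  have hcont : Continuous fun η : Fin (n + 1) → ℝ => ∫ x in ℓ..u, tangentEnvelope f η x :=
    intervalIntegral.continuous_parametric_intervalIntegral_of_continuous
      (continuous_tangentEnvelope hf hf') continuous_const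
  obtain ⟨ξ, hξ, hmax⟩ := (isCompact_weakLinearizationPoints n ℓ u).exists_isMaxOn
    ((nonempty_linearizationPoints hn hℓu).mono hsub) hcont.continuousOn
  refine ⟨ξ, ⟨hξ.1, hξ.2.1, ?_⟩, hmax.on_subset hsub⟩
  by_contra hns
  obtain ⟨j, k, c, hkj, heq, hcξ, hη⟩ := exists_move_of_not_strictMono hℓu hξ hns
  have hc : c ∈ Icc ℓ u := by simpa using weakLinearizationPoints_mem_Icc hη j
  exact (integral_tangentEnvelope_lt_of_move h hℓu (weakLinearizationPoints_mem_Icc hξ) hkj heq hc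
    hcξ).not_ge (hmax hη)

theorem integral_tangentLine (f : ℝ → ℝ) (c a b : ℝ) :
    ∫ x in a..b, tangentLine f c x = (b - a) * tangentLine f c ((a + b) / 2) := by
  have h1 : ∀ x, tangentLine f c x = (f c - deriv f c * c) + deriv f c * x := fun x => by
    unfold tangentLine
    ring
  simp only [h1]
  rw [intervalIntegral.integral_add (by simp) (Continuous.intervalIntegrable (by fun_prop) _ _),
    intervalIntegral.integral_const, intervalIntegral.integral_const_mul, integral_id]
  simp only [smul_eq_mul]
  ring

/-- At a maximizer, each interior linearization point is the midpoint of the two neighbouring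
break points. -/
theorem midpoint_of_isMaxOn (h : AboveTangents f (Icc ℓ u))
    (hξ : ξ ∈ linearizationPoints n ℓ u)
    (hmax : IsMaxOn (fun η : Fin (n + 1) → ℝ => ∫ x in ℓ..u, tangentEnvelope f η x)
      (linearizationPoints n ℓ u) ξ) {a j b : Fin (n + 1)} (haj : (a : ℕ) + 1 = j)
    (hjb : (j : ℕ) + 1 = b) :
    2 * ξ j = tangentAbscissa f (ξ a) (ξ j) + tangentAbscissa f (ξ j) (ξ b) := by
  have hmem := linearizationPoints_mem_Icc hξ
  obtain ⟨h0, hlast, hmono⟩ := hξ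
  have hltj : ∀ i < j, i ≤ a := fun i hi => by
    rw [Fin.lt_def] at hi
    rw [Fin.le_def]
    omega
  have hjlt : ∀ i, j < i → b ≤ i := fun i hi => by
    rw [Fin.lt_def] at hi
    rw [Fin.le_def]
    omega
  have haj' : a < j := by
    rw [Fin.lt_def]
    omega
  have hjb' : j < b := by
    rw [Fin.lt_def]
    omega
  set s := tangentAbscissa f (ξ a) (ξ j) with hs
  set t := tangentAbscissa f (ξ j) (ξ b) with ht
  have h1 : ξ a < s := h.lt_tangentAbscissa (hmem _) (hmem _) (hmono haj')
  have h2 : s < ξ j := h.tangentAbscissa_lt (hmem _) (hmem _) (hmono haj')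
  have h3 : ξ j < t := h.lt_tangentAbscissa (hmem _) (hmem _) (hmono hjb')
  have h4 : t < ξ b := h.tangentAbscissa_lt (hmem _) (hmem _) (hmono hjb')
  have hℓs : ℓ < s := (hmem a).1.trans_lt h1
  have htu : t < u := h4.trans_le (hmem b).2
  by_contra hne
  -- Moving `ξ j` to `m` improves the integral: outside `[s, t]` the tangent at `ξ j` is dominated
  -- by a neighbour's, so nothing is lost. On `[s, t]` it is the envelope, and an affine function
  -- integrates to length times midpoint value, which is largest for the tangent at `m`.
  set m := (s + t) / 2 with hm
  have hmj : m ≠ ξ j := fun h => hne (by linarith)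
  have hmIcc : m ∈ Icc ℓ u := ⟨by linarith, by linarith⟩
  set η := Function.update ξ j m with hη
  have hηj : η j = m := by simp [hη]
  have hηi : ∀ i ≠ j, η i = ξ i := fun i hi => by simp [hη, hi]
  have hηmem : η ∈ linearizationPoints n ℓ u := by
    refine ⟨?_, ?_, strictMono_update hmono (fun i hi => ?_) fun i hi => ?_⟩
    · rw [hηi _ ((Fin.zero_le a).trans_lt haj').ne, h0]
    · rw [hηi _ (hjb'.trans_le (Fin.le_last b)).ne', hlast]
    · linarith [hmono.monotone (hltj i hi)]
    · linarith [hmono.monotone (hjlt i hi)]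
  have hle : ∀ {x : ℝ} {k : Fin (n + 1)}, k ≠ j →
      tangentLine f (ξ j) x ≤ tangentLine f (ξ k) x →
      tangentEnvelope f ξ x ≤ tangentEnvelope f η x := by
    intro x k hk hjk
    have key : ∀ i ≠ j, tangentLine f (ξ i) x ≤ tangentEnvelope f η x := fun i hi => by
      rw [← hηi i hi]
      exact tangentLine_le_tangentEnvelope i
    refine tangentEnvelope_le_iff.2 fun i => ?_
    rcases eq_or_ne i j with rfl | hi
    · exact hjk.trans (key k hk)
    · exact key i hi
  have hint : ∀ (ζ : Fin (n + 1) → ℝ) (x y : ℝ),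
      IntervalIntegrable (tangentEnvelope f ζ) MeasureTheory.volume x y := fun ζ x y =>
    (continuous_tangentEnvelope_right ζ).intervalIntegrable x y
  have hintT : ∀ (c x y : ℝ),
      IntervalIntegrable (tangentLine f c) MeasureTheory.volume x y := fun c x y =>
    Continuous.intervalIntegrable (by unfold tangentLine; fun_prop) x y
  have i1 : ∫ x in ℓ..s, tangentEnvelope f ξ x ≤ ∫ x in ℓ..s, tangentEnvelope f η x :=
    intervalIntegral.integral_mono_on hℓs.le (hint _ _ _) (hint _ _ _) fun x hx =>
      hle haj'.ne ((h.tangentLine_le_iff (hmem _) (hmem _) (hmono haj')).2 hx.2)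
  have i3 : ∫ x in t..u, tangentEnvelope f ξ x ≤ ∫ x in t..u, tangentEnvelope f η x :=
    intervalIntegral.integral_mono_on htu.le (hint _ _ _) (hint _ _ _) fun x hx =>
      hle hjb'.ne' (not_lt.1 fun hlt =>
        ((h.tangentLine_lt_iff (hmem _) (hmem _) (hmono hjb')).1 hlt).not_ge hx.1)
  have i2 : ∫ x in s..t, tangentEnvelope f ξ x < ∫ x in s..t, tangentEnvelope f η x := by
    have hst : s < t := h2.trans h3
    calc ∫ x in s..t, tangentEnvelope f ξ x
        ≤ ∫ x in s..t, tangentLine f (ξ j) x := by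
          refine intervalIntegral.integral_mono_on hst.le (hint _ _ _) (hintT _ _ _)
            fun x hx => tangentEnvelope_le_iff.2 fun i => ?_
          -- Non-adjacent tangents cross the one at `ξ j` no closer than the adjacent ones do, hence
          -- not inside `(s, t)`.
          rcases lt_trichotomy i j with hi | rfl | hi
          · refine not_lt.1 fun hlt => ?_
            have := (h.tangentLine_lt_iff (hmem _) (hmem _) (hmono hi)).1 hlt
            have := h.tangentAbscissa_le_left (hmem i) (hmem a) (hmem j)
              (hmono.monotone (hltj i hi)) (hmono haj')
            linarith [hx.1]
          · rfl
          · refine (h.tangentLine_le_iff (hmem _) (hmem _) (hmono hi)).2 ?_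
            have := h.tangentAbscissa_le_right (hmem j) (hmem b) (hmem i)
              (hmono hjb') (hmono.monotone (hjlt i hi))
            linarith [hx.2]
      _ = (t - s) * tangentLine f (ξ j) m := integral_tangentLine _ _ _ _
      _ < (t - s) * tangentLine f m m := by
          rw [tangentLine_self]
          exact mul_lt_mul_of_pos_left (h _ (hmem j) m hmIcc hmj) (sub_pos.2 hst)
      _ = ∫ x in s..t, tangentLine f m x := (integral_tangentLine _ _ _ _).symm
      _ ≤ ∫ x in s..t, tangentEnvelope f η x := by
          refine intervalIntegral.integral_mono_on hst.le (hintT _ _ _) (hint _ _ _) fun x _ => ?_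
          rw [← hηj]
          exact tangentLine_le_tangentEnvelope j
  have hsplit : ∀ ζ : Fin (n + 1) → ℝ, ∫ x in ℓ..u, tangentEnvelope f ζ x =
      (∫ x in ℓ..s, tangentEnvelope f ζ x) + (∫ x in s..t, tangentEnvelope f ζ x) +
        ∫ x in t..u, tangentEnvelope f ζ x := fun ζ => by
    rw [intervalIntegral.integral_add_adjacent_intervals (hint _ _ _) (hint _ _ _),
      intervalIntegral.integral_add_adjacent_intervals (hint _ _ _) (hint _ _ _)]
  have hmaxη : ∫ x in ℓ..u, tangentEnvelope f η x ≤ ∫ x in ℓ..u, tangentEnvelope f ξ x :=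
    hmax hηmem
  rw [hsplit, hsplit] at hmaxη
  linarith

end Optimization

/-! ### Power functions and uniqueness of the stationary vector -/

section Power

variable {p : ℝ}

theorem deriv_rpow (hp : 1 < p) (x : ℝ) : deriv (fun x : ℝ => x ^ p) x = p * x ^ (p - 1) :=
  (Real.hasDerivAt_rpow_const (Or.inr hp.le)).deriv

theorem aboveTangents_rpow (hp : 1 < p) : AboveTangents (fun x : ℝ => x ^ p) (Ici 0) := by
  intro a ha x hx hxa
  have hd : HasDerivAt (fun x : ℝ => x ^ p) (deriv (fun x : ℝ => x ^ p) a) a := by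
    rw [deriv_rpow hp]
    exact Real.hasDerivAt_rpow_const (Or.inr hp.le)
  have hc := strictConvexOn_rpow hp
  unfold tangentLine
  rcases lt_or_gt_of_ne hxa with hlt | hlt
  · have h1 := hc.slope_lt_of_hasDerivAt hx ha hlt hd
    rw [slope_def_field, div_lt_iff₀ (sub_pos.2 hlt)] at h1
    linarith
  · have h1 := hc.lt_slope_of_hasDerivAt ha hx hlt hd
    rw [slope_def_field, lt_div_iff₀ (sub_pos.2 hlt)] at h1
    linarith

/-- The linear map (x, y) ↦ (cx, c^p y) preserves the graph and so carries tangents to tangents.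
Besides `AboveTangents`, this is all that the uniqueness argument uses about the power function. -/
theorem tangentAbscissa_rpow_mul (hp : 1 < p) {c a b : ℝ} (hc : 0 < c) (ha : 0 ≤ a)
    (hb : 0 ≤ b) : tangentAbscissa (fun x : ℝ => x ^ p) (c * a) (c * b) =
      c * tangentAbscissa (fun x : ℝ => x ^ p) a b := by
  simp only [tangentAbscissa, deriv_rpow hp, Real.mul_rpow hc.le ha, Real.mul_rpow hc.le hb]
  have h1 : c ^ p = c * c ^ (p - 1) := by
    rw [← Real.rpow_one_add' hc.le (by linarith)]
    ring_nf
  have h2 : c ^ (p - 1) ≠ 0 := (Real.rpow_pos_of_pos hc _).ne'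
  have h3 : p * (c ^ (p - 1) * a ^ (p - 1)) - p * (c ^ (p - 1) * b ^ (p - 1)) =
      c ^ (p - 1) * (p * a ^ (p - 1) - p * b ^ (p - 1)) := by ring
  rw [h1, h3]
  rw [show c * c ^ (p - 1) * b ^ p - p * (c ^ (p - 1) * b ^ (p - 1)) * (c * b) -
      (c * c ^ (p - 1) * a ^ p - p * (c ^ (p - 1) * a ^ (p - 1)) * (c * a)) =
      c ^ (p - 1) * (c * (b ^ p - p * b ^ (p - 1) * b - (a ^ p - p * a ^ (p - 1) * a))) by ring,
    mul_div_mul_left _ _ h2, mul_div_assoc]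

/-- Comparison of two stationary vectors of linearization points: the one with the larger first
step is the smaller one. -/
theorem le_of_stationary {ℓ u : ℝ} (hp : 1 < p) (hℓ : 0 ≤ ℓ) {n : ℕ} (hn : 1 ≤ n)
    {ξ η : Fin (n + 1) → ℝ}
    (hξ : ξ ∈ linearizationPoints n ℓ u) (hη : η ∈ linearizationPoints n ℓ u)
    (sξ : ∀ a j b : Fin (n + 1), (a : ℕ) + 1 = j → (j : ℕ) + 1 = b →
      2 * ξ j = tangentAbscissa (fun x : ℝ => x ^ p) (ξ a) (ξ j) +
        tangentAbscissa (fun x : ℝ => x ^ p) (ξ j) (ξ b))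
    (sη : ∀ a j b : Fin (n + 1), (a : ℕ) + 1 = j → (j : ℕ) + 1 = b →
      2 * η j = tangentAbscissa (fun x : ℝ => x ^ p) (η a) (η j) +
        tangentAbscissa (fun x : ℝ => x ^ p) (η j) (η b))
    (h1 : η ⟨1, by omega⟩ ≤ ξ ⟨1, by omega⟩) (k : Fin (n + 1)) : ξ k ≤ η k := by
  have hT := aboveTangents_rpow hp
  have nξ : ∀ i, 0 ≤ ξ i := fun i => hℓ.trans (linearizationPoints_mem_Icc hξ i).1
  have nη : ∀ i, 0 ≤ η i := fun i => hℓ.trans (linearizationPoints_mem_Icc hη i).1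
  obtain ⟨ξ0, ξl, mξ⟩ := hξ
  obtain ⟨η0, ηl, mη⟩ := hη
  have hlt : ∀ (i : ℕ) (hi : i + 1 < n + 1),
      (⟨i, by omega⟩ : Fin (n + 1)) < ⟨i + 1, hi⟩ := fun i hi => by simp [Fin.lt_def]
  -- The ratio of consecutive points is at least as large for `ξ` as for `η`; cross-multiplied
  -- because `ℓ` may be 0.
  have hcross : ∀ (i : ℕ) (hi : i + 1 < n + 1),
      ξ ⟨i, by omega⟩ * η ⟨i + 1, hi⟩ ≤ η ⟨i, by omega⟩ * ξ ⟨i + 1, hi⟩ := by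
    intro i
    induction i with
    | zero =>
      intro hi
      have e1 : ξ ⟨0, by omega⟩ = ℓ := ξ0
      have e2 : η ⟨0, by omega⟩ = ℓ := η0
      rw [e1, e2]
      exact mul_le_mul_of_nonneg_left h1 hℓ
    | succ i ih =>
      intro hi
      have ih := ih (by omega)
      have tξ := sξ ⟨i, by omega⟩ ⟨i + 1, by omega⟩ ⟨i + 1 + 1, hi⟩ rfl rfl
      have tη := sη ⟨i, by omega⟩ ⟨i + 1, by omega⟩ ⟨i + 1 + 1, hi⟩ rfl rfl
      have l1 := mξ (hlt i (by omega))
      have l2 := mξ (hlt (i + 1) hi)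
      have l3 := mη (hlt i (by omega))
      have l4 := mη (hlt (i + 1) hi)
      revert ih tξ tη l1 l2 l3 l4
      generalize hx0 : ξ ⟨i, by omega⟩ = x0
      generalize hx1 : ξ ⟨i + 1, by omega⟩ = x1
      generalize hx2 : ξ ⟨i + 1 + 1, hi⟩ = x2
      generalize hy0 : η ⟨i, by omega⟩ = y0
      generalize hy1 : η ⟨i + 1, by omega⟩ = y1
      generalize hy2 : η ⟨i + 1 + 1, hi⟩ = y2
      intro ih tξ tη l1 l2 l3 l4
      have px0 : 0 ≤ x0 := hx0 ▸ nξ _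
      have py0 : 0 ≤ y0 := hy0 ▸ nη _
      have px1 : 0 < x1 := px0.trans_lt l1
      have py1 : 0 < y1 := py0.trans_lt l3
      have px2 : 0 < x2 := px1.trans l2
      have py2 : 0 < y2 := py1.trans l4
      -- Scaling `ξ` by `y1` and `η` by `x1` brings both middle points to `y1 * x1`. The induction
      -- hypothesis then orders the left neighbours, and the conclusion orders the right ones.
      have key := hT.neighbour_antitone (a := y1 * x0) (a' := x1 * y0) (b := y1 * x2)
        (b' := x1 * y2) (m := y1 * x1) (mul_nonneg py1.le px0) (mul_nonneg px1.le py0)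
        (mul_pos py1 px2).le (mul_pos px1 py2).le (mul_pos py1 px1).le
        (by rw [mul_comm y1]; exact mul_lt_mul_of_pos_left l3 px1)
        (mul_lt_mul_of_pos_left l2 py1)
        (by rw [tangentAbscissa_rpow_mul hp py1 px0 px1.le,
          tangentAbscissa_rpow_mul hp py1 px1.le px2.le]; linear_combination y1 * tξ)
        (by rw [mul_comm y1, tangentAbscissa_rpow_mul hp px1 py0 py1.le,
          tangentAbscissa_rpow_mul hp px1 py1.le py2.le]; linear_combination x1 * tη)
        (by linarith)
      exact key
  -- Descending from the common last point `u`: at least as large ratios give points that are at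
  -- most as large.
  have hdown : ∀ (d i : ℕ) (hi : i < n + 1), i + d = n → ξ ⟨i, hi⟩ ≤ η ⟨i, hi⟩ := by
    intro d
    induction d with
    | zero =>
      intro i hi hd
      obtain rfl : i = n := by omega
      exact (ξl.trans ηl.symm).le
    | succ d ih =>
      intro i hi hd
      have h2 := ih (i + 1) (by omega) (by omega)
      have h3 := hcross i (by omega)
      have h4 : 0 < η ⟨i + 1, by omega⟩ := (nη _).trans_lt (mη (hlt i (by omega)))
      refine le_of_mul_le_mul_right (h3.trans ?_) h4
      exact mul_le_mul_of_nonneg_left h2 (nη _)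
  exact hdown (n - k) k k.2 (by omega)

/-- `le_of_stationary` at index 1 reverses the assumed order of the first steps, so it applies again
with the two vectors exchanged. -/
theorem eq_of_stationary {ℓ u : ℝ} (hp : 1 < p) (hℓ : 0 ≤ ℓ) {n : ℕ} (hn : 1 ≤ n)
    {ξ η : Fin (n + 1) → ℝ}
    (hξ : ξ ∈ linearizationPoints n ℓ u) (hη : η ∈ linearizationPoints n ℓ u)
    (sξ : ∀ a j b : Fin (n + 1), (a : ℕ) + 1 = j → (j : ℕ) + 1 = b →
      2 * ξ j = tangentAbscissa (fun x : ℝ => x ^ p) (ξ a) (ξ j) +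
        tangentAbscissa (fun x : ℝ => x ^ p) (ξ j) (ξ b))
    (sη : ∀ a j b : Fin (n + 1), (a : ℕ) + 1 = j → (j : ℕ) + 1 = b →
      2 * η j = tangentAbscissa (fun x : ℝ => x ^ p) (η a) (η j) +
        tangentAbscissa (fun x : ℝ => x ^ p) (η j) (η b)) : ξ = η := by
  funext k
  rcases le_total (η ⟨1, by omega⟩) (ξ ⟨1, by omega⟩) with h | h
  · have h1 := le_of_stationary hp hℓ hn hξ hη sξ sη h
    exact (h1 k).antisymm (le_of_stationary hp hℓ hn hη hξ sη sξ (h1 _) k)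
  · have h1 := le_of_stationary hp hℓ hn hη hξ sη sξ h
    exact (le_of_stationary hp hℓ hn hξ hη sξ sη (h1 _) k).antisymm (h1 k)

end Power

theorem mainTheorem6 (p : ℝ) (hp : 1 < p) (ℓ u : ℝ) (hℓ : 0 ≤ ℓ) (hℓu : ℓ < u)
    (n : ℕ) (hn : 1 ≤ n) :
    ∃! ξ : Fin (n + 1) → ℝ, ξ ∈ linearizationPoints n ℓ u ∧
      IsMinOn (fun η : Fin (n + 1) → ℝ => MeasureTheory.volume (powerRelaxation p η))
        (linearizationPoints n ℓ u) ξ := by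
  have h : AboveTangents (fun x : ℝ => x ^ p) (Icc ℓ u) := fun a ha x hx =>
    aboveTangents_rpow hp a (hℓ.trans ha.1) x (hℓ.trans hx.1)
  have hf0 : 0 ≤ (fun x : ℝ => x ^ p) ℓ := Real.rpow_nonneg hℓ p
  have hf1 : 0 ≤ deriv (fun x : ℝ => x ^ p) ℓ := by
    rw [deriv_rpow hp]
    exact mul_nonneg (by linarith) (Real.rpow_nonneg hℓ _)
  have hcont : Continuous fun x : ℝ => x ^ p := Real.continuous_rpow_const (by linarith)
  have hcont' : Continuous (deriv fun x : ℝ => x ^ p) := by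
    rw [funext (deriv_rpow hp)]
    exact continuous_const.mul (Real.continuous_rpow_const (by linarith))
  have hiff : ∀ ξ ∈ linearizationPoints n ℓ u,
      (IsMinOn (fun η : Fin (n + 1) → ℝ => MeasureTheory.volume (powerRelaxation p η))
        (linearizationPoints n ℓ u) ξ ↔
      IsMaxOn (fun η : Fin (n + 1) → ℝ =>
        ∫ x in ℓ..u, tangentEnvelope (fun x : ℝ => x ^ p) η x) (linearizationPoints n ℓ u) ξ) :=
    fun ξ hξ => forall₂_congr fun η hη =>
      volume_plPerspectiveRelaxation_le_iff h hℓu hf0 hf1 hn hξ hη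
  obtain ⟨ξ, hξ, hmax⟩ := exists_isMaxOn_integral_tangentEnvelope h hcont hcont' hℓu hn
  refine ⟨ξ, ⟨hξ, (hiff ξ hξ).2 hmax⟩, ?_⟩
  rintro η ⟨hη, hmin⟩
  have hmaxη := (hiff η hη).1 hmin
  exact eq_of_stationary hp hℓ hn hη hξ
    (fun a j b haj hjb => midpoint_of_isMaxOn h hη hmaxη haj hjb)
    (fun a j b haj hjb => midpoint_of_isMaxOn h hξ hmax haj hjb)
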